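/- Let $K$ be an infinite field of characteristic different from $2$ and $3$. Algebras over $K$ are not assumed to be associative, unital or finite-dimensional. An algebra is called Noetherian (respectively Artinian) if every ascending (respectively descending) sequence of its two-sided ideals is stationary. A Bernstein algebra is a pair $(A,\omega)$, where $A$ is a commutative $K$-algebra and $\omega\colon A\to K$ is a nonzero homomorphism of $K$-algebras, such that $(x^2)^2=\omega(x)^2x^2$ for all $x\in A$; its barideal is the ideal $N=\ker(\omega)$. **Theorem 3.1.** Let $(A,\omega)$ be a Bernstein algebra over $K$ with barideal $N=\ker(\omega)$. Then $A$ has a nonzero idempotent, and for every nonzero idempotent $e$ of $A$ one has $A=Ke\oplus U\oplus V$ and $N=U\oplus V$, where $U=\{u\in A : eu=\tfrac12 u\}$ and $V=\{v\in A : ev=0\}$. Moreover: 1. $A$ is Noetherian if and only if $N$, viewed as an algebra in its own right, is Noetherian. 2. $A$ is Artinian if and only if $N$, viewed as an algebra in its own right, is Artinian. -/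

import Mathlib

namespace BernsteinAlgebra

section Ideals

variable (K : Type*) [Field K] (A : Type*) [NonUnitalNonAssocRing A] [Module K A]

/-- The (two-sided) ideals of a not necessarily associative or unital `K`-algebra `A`:
the `K`-subspaces of `A` absorbing multiplication by elements of `A` on both sides,
ordered by inclusion. -/
abbrev AlgIdeal : Type _ :=
  {I : Submodule K A // ∀ (a x : A), x ∈ I → a * x ∈ I ∧ x * a ∈ I}

/-- `A` is Noetherian: every ascending sequence of ideals is stationary. -/
def IsNoetherianAlg : Prop :=
  ∀ I : ℕ → AlgIdeal K A, Monotone I → ∃ n, ∀ m, n ≤ m → I m = I n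

/-- `A` is Artinian: every descending sequence of ideals is stationary. -/
def IsArtinianAlg : Prop :=
  ∀ I : ℕ → AlgIdeal K A, Antitone I → ∃ n, ∀ m, n ≤ m → I m = I n

end Ideals

section Bernstein

variable {K : Type*} [Field K] {A : Type*} [NonUnitalNonAssocCommRing A] [Module K A]

/-- The commutative `K`-algebra `A` with weight function `ω` is a Bernstein algebra. -/
structure IsBernstein (ω : A →ₙₐ[K] K) : Prop where
  weight_ne_zero : ω ≠ 0
  sq_sq : ∀ x : A, (x * x) * (x * x) = (ω x) ^ 2 • (x * x)

/-- The barideal `N = ker ω`, as a subalgebra of `A`; its coercion to a type is `N` regarded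
as an algebra in its own right. -/
def barideal (ω : A →ₙₐ[K] K) : NonUnitalSubalgebra K A where
  carrier := {x | ω x = 0}
  zero_mem' := map_zero ω
  add_mem' {x y} hx hy := by
    simp only [Set.mem_ofPred_eq] at hx hy ⊢
    rw [map_add, hx, hy, add_zero]
  mul_mem' {x y} hx hy := by
    simp only [Set.mem_ofPred_eq] at hx hy ⊢
    rw [map_mul, hx, zero_mul]
  smul_mem' c x hx := by
    simp only [Set.mem_ofPred_eq] at hx ⊢
    rw [map_smul, hx, smul_zero]

variable (K) [IsScalarTower K A A] [SMulCommClass K A A]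

/-- The Peirce component `U = {u ∈ A | e u = (1/2) u}`. -/
def peirceU (e : A) : Submodule K A :=
  Module.End.eigenspace (LinearMap.mulLeft K e) (1 / 2 : K)

/-- The Peirce component `V = {v ∈ A | e v = 0}`. -/
def peirceV (e : A) : Submodule K A :=
  LinearMap.ker (LinearMap.mulLeft K e)

end Bernstein

end BernsteinAlgebra

set_option linter.unusedSectionVars false

namespace BernsteinAlgebra

section Scalars

variable {K : Type*} [Field K]

/-! Chain conditions pull back along strictly monotone maps. From `A` to `N`, an ideal `I` goes to
`I ∩ N` and the truth value of `I ⊄ N`. The converse is harder, since ideals of `N` need not be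
stable under `e`. With `L` the annihilator of `U` in `U`, send `J` to `J ∩ L`, the core of `J + L`
(its largest `e`-stable subspace) and the hull of `J + L` (the least `e`-stable subspace containing
it). All three are ideals of `A`; `L` is added because `V² ⊆ L` makes the hull an ideal. Core and
hull separate comparable ideals, and the modular law recovers `J` from `J ∩ L` and `J + L`. -/

theorem three_ne_zero_of_ringChar_ne (h : ringChar K ≠ 3) : (3 : K) ≠ 0 := by
  intro h0
  have hd : ringChar K ∣ 3 := (ringChar.spec K 3).1 (by exact_mod_cast h0)
  rcases (Nat.dvd_prime Nat.prime_three).1 hd with h1 | h1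
  · exact CharP.ringChar_ne_one h1
  · exact h h1

end Scalars

section Idempotents

variable {K : Type*} [Field K] {A : Type*} [NonUnitalNonAssocCommRing A] [Module K A]
  {ω : A →ₙₐ[K] K}

theorem IsBernstein.weight_idempotent {e : A} (hA : IsBernstein ω) (h0 : e ≠ 0) (he : e * e = e) :
    ω e = 1 := by
  have h := congrArg ω he
  rw [map_mul] at h
  have hne : ω e ≠ 0 := by
    intro hz
    have := hA.sq_sq e
    simp only [he, hz] at this
    simp at this
    exact h0 this
  exact mul_left_cancel₀ hne (by rw [h, mul_one])

theorem IsBernstein.exists_idempotent (hA : IsBernstein ω) : ∃ e : A, e ≠ 0 ∧ e * e = e := by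
  obtain ⟨x, hx⟩ : ∃ x, ω x ≠ 0 := by
    by_contra! h
    exact hA.weight_ne_zero (by ext x; simp [h x])
  have h1 : ω ((ω x)⁻¹ • x) = 1 := by simp [hx]
  generalize (ω x)⁻¹ • x = y at h1
  refine ⟨y * y, ?_, ?_⟩
  · intro h
    have := congrArg ω h
    simp [h1] at this
  · rw [hA.sq_sq, h1]
    simp

end Idempotents

/-! ### Polarizations of the Bernstein identity -/

section Identities

variable {K : Type*} [Field K] {A : Type*} [NonUnitalNonAssocCommRing A] [Module K A]
  [IsScalarTower K A A] [SMulCommClass K A A] {ω : A →ₙₐ[K] K}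

/-- First polarization of the Bernstein identity. -/
theorem IsBernstein.sq_mul_mul (hA : IsBernstein ω) (h2 : (2 : K) ≠ 0) (h3 : (3 : K) ≠ 0)
    (x y : A) :
    (2 : K) • ((x * x) * (x * y)) = ω x ^ 2 • (x * y) + (ω x * ω y) • (x * x) := by
  have expand (t : K) := hA.sq_sq (x + t • y)
  have hs (t : K) : (x + t • y) * (x + t • y) =
      x * x + (2 * t) • (x * y) + (t ^ 2) • (y * y) := by
    simp only [mul_add, add_mul, smul_mul_assoc, mul_smul_comm, mul_comm y x]
    module
  have hq (p q r : A) (a b : K) : (p + a • q + b • r) * (p + a • q + b • r) =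
      p * p + (2 * a) • (p * q) + (2 * b) • (p * r) + (a ^ 2) • (q * q) +
        (2 * a * b) • (q * r) + (b ^ 2) • (r * r) := by
    simp only [mul_add, add_mul, smul_mul_assoc, mul_smul_comm, mul_comm q p, mul_comm r p,
      mul_comm r q]
    module
  simp only [hs, hq, map_add, map_smul, smul_eq_mul] at expand
  -- Combining t = ±1, ±2 as 8(f(1) - f(-1)) - (f(2) - f(-2)) cancels the even and cubic terms and
  -- leaves 12 times the linear coefficient, itself twice the claim: hence 24.
  have e1 := expand 1
  have e2 := expand (-1)
  have e3 := expand 2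
  have e4 := expand (-2)
  have h24 : (24 : K) ≠ 0 := by
    have : (24 : K) = 2 * 2 * 2 * 3 := by norm_num
    rw [this]
    simp [h2, h3]
  apply smul_right_injective A h24
  linear_combination (norm := module) (8 : K) • e1 - (8 : K) • e2 - e3 + e4

/-- Second polarization of the Bernstein identity. -/
theorem IsBernstein.mul_mul_mul (hA : IsBernstein ω) (h2 : (2 : K) ≠ 0) (h3 : (3 : K) ≠ 0)
    (x y z : A) :
    (4 : K) • ((x * y) * (x * z)) + (2 : K) • ((x * x) * (y * z)) =
      (2 * ω x * ω y) • (x * z) + (2 * ω x * ω z) • (x * y) + ω x ^ 2 • (y * z) +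
        (ω y * ω z) • (x * x) := by
  have e1 := hA.sq_mul_mul h2 h3 (x + y) z
  have e2 := hA.sq_mul_mul h2 h3 (x - y) z
  have e3 := hA.sq_mul_mul h2 h3 y z
  apply smul_right_injective A h2
  simp only [mul_add, add_mul, mul_sub, sub_mul, map_add, map_sub, mul_comm y x] at e1 e2 ⊢
  linear_combination (norm := module) e1 - e2 - (2 : K) • e3

/-- Full polarization of the Bernstein identity, on three elements of the barideal. -/
theorem IsBernstein.mul_mul_add_cyclic (hA : IsBernstein ω) (h2 : (2 : K) ≠ 0)
    (h3 : (3 : K) ≠ 0) (a : A) {x y z : A} (hx : ω x = 0) (hy : ω y = 0) (hz : ω z = 0) :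
    (a * x) * (y * z) + (a * y) * (x * z) + (a * z) * (x * y) = 0 := by
  have e1 := hA.mul_mul_mul h2 h3 (a + x) y z
  have e2 := hA.mul_mul_mul h2 h3 a y z
  have e3 := hA.mul_mul_mul h2 h3 x y z
  have h4 : (4 : K) ≠ 0 := by
    have : (4 : K) = 2 * 2 := by norm_num
    rw [this]
    simp [h2]
  apply smul_right_injective A h4
  simp only [mul_add, add_mul, map_add, hx, hy, hz, mul_comm x a, mul_comm (x * y) (a * z)]
    at e1 e2 e3 ⊢
  linear_combination (norm := module) e1 - e2 - e3

variable {e : A}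

theorem IsBernstein.idem_mul_idem_mul (hA : IsBernstein ω) (h2 : (2 : K) ≠ 0)
    (h3 : (3 : K) ≠ 0) (he : e * e = e) (hω : ω e = 1) {x : A} (hx : ω x = 0) :
    e * (e * x) = (1 / 2 : K) • (e * x) := by
  have h := hA.sq_mul_mul h2 h3 e x
  simp only [he, hω, hx, one_pow, one_smul, mul_zero, zero_smul, add_zero] at h
  rw [one_div, eq_inv_smul_iff₀ h2, h]

theorem IsBernstein.idem_mul_mul (hA : IsBernstein ω) (h2 : (2 : K) ≠ 0)
    (h3 : (3 : K) ≠ 0) (he : e * e = e) (hω : ω e = 1) {x y : A} (hx : ω x = 0)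
    (hy : ω y = 0) :
    e * (x * y) = (1 / 2 : K) • (x * y) - (2 : K) • ((e * x) * (e * y)) := by
  have h := hA.mul_mul_mul h2 h3 e x y
  simp only [he, hω, hx, hy, one_pow, one_smul, mul_zero, zero_smul, add_zero, zero_add] at h
  apply smul_right_injective A h2
  simp only [smul_sub, smul_smul, mul_one_div_cancel h2, one_smul]
  linear_combination (norm := module) h

end Identities
-- Peirce decomposition
section Peirce

variable {K : Type*} [Field K] {A : Type*} [NonUnitalNonAssocCommRing A] [Module K A]
  [IsScalarTower K A A] [SMulCommClass K A A] {ω : A →ₙₐ[K] K} {e : A}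

theorem mem_peirceU {x : A} : x ∈ peirceU K e ↔ e * x = (1 / 2 : K) • x := by
  simp [peirceU]

theorem mem_peirceV {x : A} : x ∈ peirceV K e ↔ e * x = 0 := by
  simp [peirceV]

theorem weight_of_mem_peirceU (h2 : (2 : K) ≠ 0) (hω : ω e = 1) {x : A}
    (hx : x ∈ peirceU K e) : ω x = 0 := by
  have h := congrArg ω (mem_peirceU.1 hx)
  simp only [map_mul, map_smul, hω, one_mul, smul_eq_mul] at h
  have h' : 2 * ω x = ω x := by
    nth_rw 1 [h]
    rw [← mul_assoc, mul_one_div_cancel h2, one_mul]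
  linear_combination h'

theorem weight_of_mem_peirceV (hω : ω e = 1) {x : A} (hx : x ∈ peirceV K e) : ω x = 0 := by
  have h := congrArg ω (mem_peirceV.1 hx)
  simpa [hω] using h

/-- The projection of an element of the barideal to `U`. -/
theorem IsBernstein.two_smul_idem_mul_mem_peirceU (hA : IsBernstein ω) (h2 : (2 : K) ≠ 0)
    (h3 : (3 : K) ≠ 0) (he : e * e = e) (hω : ω e = 1) {x : A} (hx : ω x = 0) :
    (2 : K) • (e * x) ∈ peirceU K e := by
  rw [mem_peirceU, mul_smul_comm, hA.idem_mul_idem_mul h2 h3 he hω hx, smul_comm]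

/-- The projection of an element of the barideal to `V`. -/
theorem IsBernstein.sub_two_smul_idem_mul_mem_peirceV (hA : IsBernstein ω) (h2 : (2 : K) ≠ 0)
    (h3 : (3 : K) ≠ 0) (he : e * e = e) (hω : ω e = 1) {x : A} (hx : ω x = 0) :
    x - (2 : K) • (e * x) ∈ peirceV K e := by
  rw [mem_peirceV, mul_sub, mul_smul_comm, hA.idem_mul_idem_mul h2 h3 he hω hx, smul_smul,
    mul_one_div_cancel h2, one_smul, sub_self]

theorem IsBernstein.barideal_eq_sup (hA : IsBernstein ω) (h2 : (2 : K) ≠ 0)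
    (h3 : (3 : K) ≠ 0) (he : e * e = e) (hω : ω e = 1) :
    (barideal ω).toSubmodule = peirceU K e ⊔ peirceV K e := by
  apply le_antisymm
  · intro x hx
    have hx : ω x = 0 := hx
    rw [← add_sub_cancel ((2 : K) • (e * x)) x]
    exact Submodule.add_mem_sup (hA.two_smul_idem_mul_mem_peirceU h2 h3 he hω hx)
      (hA.sub_two_smul_idem_mul_mem_peirceV h2 h3 he hω hx)
  · exact sup_le (fun x hx => weight_of_mem_peirceU h2 hω hx)
      (fun x hx => weight_of_mem_peirceV hω hx)

theorem IsBernstein.isInternal_peirce (hA : IsBernstein ω) (h2 : (2 : K) ≠ 0)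
    (h3 : (3 : K) ≠ 0) (he : e * e = e) (hω : ω e = 1) :
    DirectSum.IsInternal ![Submodule.span K {e}, peirceU K e, peirceV K e] := by
  rw [DirectSum.isInternal_submodule_iff_iSupIndep_and_iSup_eq_top]
  constructor
  -- The summands lie in eigenspaces of multiplication by `e` for distinct eigenvalues.
  · have hinj : Function.Injective ![(1 : K), 1 / 2, 0] := by
      have h12 : (1 : K) ≠ 1 / 2 := by
        rw [ne_eq, eq_div_iff h2, one_mul]
        intro h
        exact one_ne_zero (α := K) (by linear_combination h)
      have h20 : (1 / 2 : K) ≠ 0 := one_div_ne_zero h2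
      intro i j hij
      fin_cases i <;> fin_cases j <;> simp_all
    refine ((Module.End.eigenspaces_iSupIndep (LinearMap.mulLeft K e)).comp hinj).mono ?_
    intro i
    fin_cases i
    · simp [Submodule.span_le, he]
    · exact le_rfl
    · simp [peirceV, Module.End.eigenspace_zero]
  · rw [eq_top_iff]
    intro x _
    have hn : x - ω x • e ∈ (barideal ω).toSubmodule := by
      change ω (x - ω x • e) = 0
      simp [hω]
    rw [hA.barideal_eq_sup h2 h3 he hω] at hn
    have hsub : ∀ i, ![Submodule.span K {e}, peirceU K e, peirceV K e] i ≤
      ⨆ i, ![Submodule.span K {e}, peirceU K e, peirceV K e] i := le_iSup _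
    rw [← add_sub_cancel (ω x • e) x]
    exact add_mem (hsub 0 (Submodule.smul_mem _ _ (Submodule.mem_span_singleton_self e)))
      (sup_le (hsub 1) (hsub 2) hn)

end Peirce

/-! ### Ideals of the barideal and their `e`-stable approximations -/

section Ideals

variable {K : Type*} [Field K] {A : Type*} [NonUnitalNonAssocCommRing A] [Module K A]
  [IsScalarTower K A A] [SMulCommClass K A A] {ω : A →ₙₐ[K] K} {e : A}

/-- A subspace of `A` is an ideal of the barideal of `(A, ω)`. -/
def IsBaridealIdeal (ω : A →ₙₐ[K] K) (J : Submodule K A) : Prop :=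
  (∀ x ∈ J, ω x = 0) ∧ ∀ a x, ω a = 0 → x ∈ J → a * x ∈ J

/-- An ideal of the barideal stable under an element of weight one is an ideal of `A`. -/
theorem IsBaridealIdeal.mul_mem {J : Submodule K A} (hJ : IsBaridealIdeal ω J) (hω : ω e = 1)
    (hJe : ∀ x ∈ J, e * x ∈ J) (a x : A) (hx : x ∈ J) : a * x ∈ J ∧ x * a ∈ J := by
  have h : a * x ∈ J := by
    rw [← add_sub_cancel (ω a • e) a, add_mul, smul_mul_assoc]
    exact add_mem (J.smul_mem _ (hJe x hx)) (hJ.2 _ _ (by simp [hω]) hx)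
  exact ⟨h, mul_comm a x ▸ h⟩

/-- The subspace of `U` of the elements annihilating `U`. -/
def annihilatorU (K : Type*) [Field K] {A : Type*} [NonUnitalNonAssocCommRing A] [Module K A]
    [IsScalarTower K A A] [SMulCommClass K A A] (e : A) : Submodule K A where
  carrier := {x | x ∈ peirceU K e ∧ ∀ u ∈ peirceU K e, u * x = 0}
  zero_mem' := ⟨zero_mem _, fun u _ => mul_zero u⟩
  add_mem' hx hy := ⟨add_mem hx.1 hy.1, fun u hu => by
    rw [mul_add, hx.2 u hu, hy.2 u hu, add_zero]⟩
  smul_mem' c x hx := ⟨Submodule.smul_mem _ c hx.1, fun u hu => by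
    rw [mul_smul_comm, hx.2 u hu, smul_zero]⟩

theorem mem_annihilatorU {x : A} :
    x ∈ annihilatorU K e ↔ x ∈ peirceU K e ∧ ∀ u ∈ peirceU K e, u * x = 0 := Iff.rfl

/-- `V N ⊆ U`. -/
theorem IsBernstein.mul_mem_peirceU (hA : IsBernstein ω) (h2 : (2 : K) ≠ 0)
    (h3 : (3 : K) ≠ 0) (he : e * e = e) (hω : ω e = 1) {x v : A} (hx : ω x = 0)
    (hv : v ∈ peirceV K e) : v * x ∈ peirceU K e := by
  rw [mem_peirceU, hA.idem_mul_mul h2 h3 he hω (weight_of_mem_peirceV hω hv) hx,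
    mem_peirceV.1 hv, zero_mul, smul_zero, sub_zero]

/-- `V² ⊆ U` annihilates `U`. -/
theorem IsBernstein.mul_mem_annihilatorU (hA : IsBernstein ω) (h2 : (2 : K) ≠ 0)
    (h3 : (3 : K) ≠ 0) (he : e * e = e) (hω : ω e = 1) {v w : A}
    (hv : v ∈ peirceV K e) (hw : w ∈ peirceV K e) : v * w ∈ annihilatorU K e := by
  have hwv := weight_of_mem_peirceV hω hv
  have hww := weight_of_mem_peirceV hω hw
  refine ⟨hA.mul_mem_peirceU h2 h3 he hω hww hv, fun u hu => ?_⟩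
  have h := hA.mul_mul_add_cyclic h2 h3 e (weight_of_mem_peirceU h2 hω hu) hwv hww
  rw [mem_peirceU.1 hu, mem_peirceV.1 hv, mem_peirceV.1 hw, zero_mul, zero_mul, add_zero,
    add_zero, smul_mul_assoc] at h
  exact (smul_eq_zero.1 h).resolve_left (one_div_ne_zero h2)

/-- Only products with `v ∈ V` matter. The cyclic identity at `e, u, v, x` gives `u(vx) + x(uv) = 0`
up to a factor 1/2, and `x` kills `uv ∈ U`. -/
theorem IsBernstein.isBaridealIdeal_annihilatorU (hA : IsBernstein ω) (h2 : (2 : K) ≠ 0)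
    (h3 : (3 : K) ≠ 0) (he : e * e = e) (hω : ω e = 1) :
    IsBaridealIdeal ω (annihilatorU K e) := by
  refine ⟨fun x hx => weight_of_mem_peirceU h2 hω hx.1, fun a x ha hx => ?_⟩
  have hu := hA.two_smul_idem_mul_mem_peirceU h2 h3 he hω ha
  have hv := hA.sub_two_smul_idem_mul_mem_peirceV h2 h3 he hω ha
  rw [← add_sub_cancel ((2 : K) • (e * a)) a, add_mul, hx.2 _ hu, zero_add]
  generalize a - (2 : K) • (e * a) = v at hv
  have hwx := weight_of_mem_peirceU h2 hω hx.1
  have hwv := weight_of_mem_peirceV hω hv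
  refine ⟨hA.mul_mem_peirceU h2 h3 he hω hwx hv, fun u hu => ?_⟩
  have h := hA.mul_mul_add_cyclic h2 h3 e (weight_of_mem_peirceU h2 hω hu) hwv hwx
  rw [mem_peirceU.1 hu, mem_peirceV.1 hv, mem_peirceU.1 hx.1, zero_mul, add_zero,
    smul_mul_assoc, smul_mul_assoc, mul_comm x (u * v)] at h
  have hxu : (u * v) * x = 0 :=
    hx.2 _ (mul_comm v u ▸ hA.mul_mem_peirceU h2 h3 he hω (weight_of_mem_peirceU h2 hω hu) hv)
  rw [hxu, smul_zero, add_zero] at h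
  exact (smul_eq_zero.1 h).resolve_left (one_div_ne_zero h2)

theorem IsBaridealIdeal.inf {I J : Submodule K A} (hI : IsBaridealIdeal ω I)
    (hJ : IsBaridealIdeal ω J) : IsBaridealIdeal ω (I ⊓ J) :=
  ⟨fun x hx => hI.1 x hx.1, fun a x ha hx => ⟨hI.2 a x ha hx.1, hJ.2 a x ha hx.2⟩⟩

theorem IsBaridealIdeal.sup {I J : Submodule K A} (hI : IsBaridealIdeal ω I)
    (hJ : IsBaridealIdeal ω J) : IsBaridealIdeal ω (I ⊔ J) := by
  constructor
  · intro x hx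
    obtain ⟨y, hy, z, hz, rfl⟩ := Submodule.mem_sup.1 hx
    rw [map_add, hI.1 y hy, hJ.1 z hz, add_zero]
  · intro a x ha hx
    obtain ⟨y, hy, z, hz, rfl⟩ := Submodule.mem_sup.1 hx
    rw [mul_add]
    exact Submodule.add_mem_sup (hI.2 a y ha hy) (hJ.2 a z ha hz)

/-- The elements `x` of `J` with `e x ∈ J`. -/
def idemCore (e : A) (J : Submodule K A) : Submodule K A :=
  J ⊓ J.comap (LinearMap.mulLeft K e)

/-- The subspace `J + e J`. -/
def idemHull (e : A) (J : Submodule K A) : Submodule K A :=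
  J ⊔ J.map (LinearMap.mulLeft K e)

theorem idemCore_mono (e : A) : Monotone (idemCore (K := K) e) :=
  fun _ _ h => inf_le_inf h (Submodule.comap_mono h)

theorem idemHull_mono (e : A) : Monotone (idemHull (K := K) e) :=
  fun _ _ h => sup_le_sup h (Submodule.map_mono h)

theorem mem_idemHull {J : Submodule K A} {x : A} :
    x ∈ idemHull e J ↔ ∃ y ∈ J, ∃ z ∈ J, y + e * z = x := by
  simp [idemHull, Submodule.mem_sup]

theorem idem_mul_mem_idemHull {J : Submodule K A} {x : A} (hx : x ∈ J) : e * x ∈ idemHull e J :=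
  mem_idemHull.2 ⟨0, zero_mem _, x, hx, zero_add _⟩

theorem IsBernstein.idem_mul_mem_idemCore (hA : IsBernstein ω) (h2 : (2 : K) ≠ 0)
    (h3 : (3 : K) ≠ 0) (he : e * e = e) (hω : ω e = 1) {J : Submodule K A}
    (hJ : IsBaridealIdeal ω J) {x : A} (hx : x ∈ idemCore e J) : e * x ∈ idemCore e J := by
  refine ⟨hx.2, ?_⟩
  change e * (e * x) ∈ J
  rw [hA.idem_mul_idem_mul h2 h3 he hω (hJ.1 x hx.1)]
  exact J.smul_mem _ hx.2

/-- Follows from `e(ax) = ½ax - 2(ea)(ex)`, where `ea` lies in `N` and `ex` in `J`. -/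
theorem IsBernstein.isBaridealIdeal_idemCore (hA : IsBernstein ω) (h2 : (2 : K) ≠ 0)
    (h3 : (3 : K) ≠ 0) (he : e * e = e) (hω : ω e = 1) {J : Submodule K A}
    (hJ : IsBaridealIdeal ω J) : IsBaridealIdeal ω (idemCore e J) := by
  refine ⟨fun x hx => hJ.1 x hx.1, fun a x ha hx => ⟨hJ.2 a x ha hx.1, ?_⟩⟩
  change e * (a * x) ∈ J
  rw [hA.idem_mul_mul h2 h3 he hω ha (hJ.1 x hx.1)]
  exact sub_mem (J.smul_mem _ (hJ.2 a x ha hx.1))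
    (J.smul_mem _ (hJ.2 _ _ (by rw [map_mul, ha, mul_zero]) hx.2))

theorem IsBernstein.idem_mul_mem_idemHull (hA : IsBernstein ω) (h2 : (2 : K) ≠ 0)
    (h3 : (3 : K) ≠ 0) (he : e * e = e) (hω : ω e = 1) {J : Submodule K A}
    (hJ : IsBaridealIdeal ω J) {x : A} (hx : x ∈ idemHull e J) : e * x ∈ idemHull e J := by
  obtain ⟨y, hy, z, hz, rfl⟩ := mem_idemHull.1 hx
  rw [mul_add, hA.idem_mul_idem_mul h2 h3 he hω (hJ.1 z hz)]
  exact add_mem (BernsteinAlgebra.idem_mul_mem_idemHull hy)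
    (Submodule.smul_mem _ _ (BernsteinAlgebra.idem_mul_mem_idemHull hz))

theorem IsBernstein.isBaridealIdeal_idemHull (hA : IsBernstein ω) (h2 : (2 : K) ≠ 0)
    (h3 : (3 : K) ≠ 0) (he : e * e = e) (hω : ω e = 1) {J : Submodule K A}
    (hJ : IsBaridealIdeal ω J) (hLJ : annihilatorU K e ≤ J) :
    IsBaridealIdeal ω (idemHull e J) := by
  refine ⟨fun x hx => ?_, fun a x ha hx => ?_⟩
  · obtain ⟨y, hy, z, hz, rfl⟩ := mem_idemHull.1 hx
    rw [map_add, map_mul, hJ.1 y hy, hJ.1 z hz, mul_zero, add_zero]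
  · obtain ⟨y, hy, z, hz, rfl⟩ := mem_idemHull.1 hx
    have hJH : J ≤ idemHull e J := le_sup_left
    rw [mul_add]
    refine add_mem (hJH (hJ.2 a y ha hy)) ?_
    have hzw := hJ.1 z hz
    have haz := hJ.2 a z ha hz
    have hv := hA.sub_two_smul_idem_mul_mem_peirceV h2 h3 he hω ha
    have hvz := hLJ (hA.mul_mem_annihilatorU h2 h3 he hω hv
      (hA.sub_two_smul_idem_mul_mem_peirceV h2 h3 he hω hzw))
    have hvJ := hJ.2 _ z (weight_of_mem_peirceV hω hv) hz
    have key : (2 : K) • (a * (e * z)) ∈ idemHull e J := by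
      have e1 := hA.idem_mul_mul h2 h3 he hω ha hzw
      -- With `v`, `z'` the `V`-parts of `a`, `z`: the first bracket is `4(ea)(ez)`, the second is
      -- `v(2ez) = vz - vz'`, and `vz' ∈ V² ⊆ L ⊆ J`.
      have hrw : (2 : K) • (a * (e * z)) =
          (a * z - (2 : K) • (e * (a * z))) + ((a - (2 : K) • (e * a)) * z -
            (a - (2 : K) • (e * a)) * (z - (2 : K) • (e * z))) := by
        simp only [mul_sub, sub_mul, smul_mul_assoc, mul_smul_comm, e1, smul_sub, smul_smul,
          mul_one_div_cancel h2]
        module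
      rw [hrw]
      exact add_mem (sub_mem (hJH haz)
        (Submodule.smul_mem _ _ (BernsteinAlgebra.idem_mul_mem_idemHull haz)))
        (hJH (sub_mem hvJ hvz))
    have := Submodule.smul_mem _ (2 : K)⁻¹ key
    rwa [smul_smul, inv_mul_cancel₀ h2, one_smul] at this

/-- An ideal of the barideal is determined, inside a bigger one, by its core and its hull. -/
theorem IsBernstein.le_of_idemCore_le_of_idemHull_le (hA : IsBernstein ω) (h2 : (2 : K) ≠ 0)
    (h3 : (3 : K) ≠ 0) (he : e * e = e) (hω : ω e = 1) {I J : Submodule K A}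
    (hJ : IsBaridealIdeal ω J) (hIJ : I ≤ J) (hcore : idemCore e J ≤ idemCore e I)
    (hhull : idemHull e J ≤ idemHull e I) : J ≤ I := by
  intro x hx
  obtain ⟨y, hy, z, hz, rfl⟩ := mem_idemHull.1 (hhull (Submodule.mem_sup_left hx))
  have hez : e * z ∈ J := (Submodule.add_mem_iff_right _ (hIJ hy)).1 hx
  -- As `e(ez) = ½ez`, having `ez` in `J` already puts it in the core of `J`.
  refine add_mem hy (hcore ⟨hez, ?_⟩).1
  change e * (e * z) ∈ J
  rw [hA.idem_mul_idem_mul h2 h3 he hω (hJ.1 z (hIJ hz))]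
  exact J.smul_mem _ hez

end Ideals

/-! ### Transfer of chain conditions -/

section Chains

variable {K : Type*} [Field K] {A : Type*}

theorem isNoetherianAlg_iff [NonUnitalNonAssocRing A] [Module K A] :
    IsNoetherianAlg K A ↔ WellFoundedGT (AlgIdeal K A) := by
  rw [wellFoundedGT_iff_monotone_chain_condition]
  refine ⟨fun h a => ?_, fun h I hI => ?_⟩
  · obtain ⟨n, hn⟩ := h a a.monotone
    exact ⟨n, fun m hm => (hn m hm).symm⟩
  · obtain ⟨n, hn⟩ := h ⟨I, hI⟩
    exact ⟨n, fun m hm => (hn m hm).symm⟩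

theorem isArtinianAlg_iff [NonUnitalNonAssocRing A] [Module K A] :
    IsArtinianAlg K A ↔ WellFoundedLT (AlgIdeal K A) := by
  rw [← wellFoundedGT_dual_iff, wellFoundedGT_iff_monotone_chain_condition]
  refine ⟨fun h a => ?_, fun h I hI => ?_⟩
  · obtain ⟨n, hn⟩ := h (fun k => OrderDual.ofDual (a k)) (fun _ _ hij => a.monotone hij)
    exact ⟨n, fun m hm => (hn m hm).symm⟩
  · obtain ⟨n, hn⟩ := h ⟨fun k => OrderDual.toDual (I k), fun _ _ hij => hI hij⟩
    exact ⟨n, fun m hm => (hn m hm).symm⟩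

variable [NonUnitalNonAssocCommRing A] [Module K A] {ω : A →ₙₐ[K] K}

/-- The inclusion of the barideal as a linear map. -/
def baridealIncl (ω : A →ₙₐ[K] K) : barideal ω →ₗ[K] A where
  toFun x := x
  map_add' _ _ := rfl
  map_smul' _ _ := rfl

theorem baridealIncl_injective (ω : A →ₙₐ[K] K) : Function.Injective (baridealIncl ω) :=
  Subtype.val_injective

theorem isBaridealIdeal_map (J : AlgIdeal K (barideal ω)) :
    IsBaridealIdeal ω (J.1.map (baridealIncl ω)) := by
  constructor
  · rintro _ ⟨y, -, rfl⟩
    exact y.2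
  · rintro a _ ha ⟨y, hy, rfl⟩
    exact ⟨⟨a, ha⟩ * y, (J.2 ⟨a, ha⟩ y hy).1, rfl⟩

/-- The intersection of an ideal of `A` with the barideal. -/
def restrictIdeal (ω : A →ₙₐ[K] K) (I : AlgIdeal K A) : AlgIdeal K (barideal ω) :=
  ⟨I.1.comap (baridealIncl ω), fun a x hx => I.2 a x hx⟩

/-- `N` has codimension at most one, so beyond `I ∩ N` it only matters whether `I` leaves `N`:
subtracting a multiple of some `y ∈ I` of nonzero weight moves any element into `N`. -/
theorem strictMono_restrictIdeal_prod (ω : A →ₙₐ[K] K) :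
    StrictMono fun I : AlgIdeal K A => (restrictIdeal ω I, ∃ x ∈ I.1, ω x ≠ 0) := by
  intro I J hIJ
  refine lt_of_le_not_ge ⟨fun x hx => hIJ.le hx, fun ⟨x, hx, hw⟩ => ⟨x, hIJ.le hx, hw⟩⟩
    fun hge => hIJ.not_ge fun x hx => ?_
  have hker : ∀ z ∈ J.1, ω z = 0 → z ∈ I.1 := fun z hz hwz =>
    hge.1 (show (⟨z, hwz⟩ : barideal ω) ∈ (restrictIdeal ω J).1 from hz)
  by_cases hw : ω x = 0
  · exact hker x hx hw
  · obtain ⟨y, hy, hwy⟩ := hge.2 ⟨x, hx, hw⟩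
    have hc : (ω x / ω y) • y ∈ I.1 := I.1.smul_mem _ hy
    have hz := hker (x - (ω x / ω y) • y) (sub_mem hx (hIJ.le hc)) (by simp [hwy])
    simpa using add_mem hz hc

theorem IsBernstein.exists_strictMono [IsScalarTower K A A] [SMulCommClass K A A]
    (hA : IsBernstein ω) (h2 : (2 : K) ≠ 0) (h3 : (3 : K) ≠ 0) :
    ∃ F : AlgIdeal K (barideal ω) → AlgIdeal K A × AlgIdeal K A × AlgIdeal K A,
      StrictMono F := by
  obtain ⟨e, h0, he⟩ := hA.exists_idempotent
  have hω := hA.weight_idempotent h0 he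
  set L := annihilatorU K e
  have hL : IsBaridealIdeal ω L := hA.isBaridealIdeal_annihilatorU h2 h3 he hω
  let M (J : AlgIdeal K (barideal ω)) := J.1.map (baridealIncl ω)
  have hM (J) : IsBaridealIdeal ω (M J) := isBaridealIdeal_map J
  have hMmono : Monotone M := fun _ _ h => Submodule.map_mono h
  have hS (J) : IsBaridealIdeal ω (M J ⊔ L) := (hM J).sup hL
  have hSmono : Monotone fun J => M J ⊔ L := fun _ _ h => sup_le_sup_right (hMmono h) _
  refine ⟨fun J => (⟨M J ⊓ L, ((hM J).inf hL).mul_mem hω fun x hx => ?_⟩,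
    ⟨idemCore e (M J ⊔ L), (hA.isBaridealIdeal_idemCore h2 h3 he hω (hS J)).mul_mem hω
      fun x => hA.idem_mul_mem_idemCore h2 h3 he hω (hS J)⟩,
    ⟨idemHull e (M J ⊔ L),
      (hA.isBaridealIdeal_idemHull h2 h3 he hω (hS J) le_sup_right).mul_mem hω
      fun x => hA.idem_mul_mem_idemHull h2 h3 he hω (hS J)⟩), fun I J hIJ => ?_⟩
  · rw [mem_peirceU.1 hx.2.1]
    exact Submodule.smul_mem _ _ hx
  · refine lt_of_le_not_ge ⟨inf_le_inf_right _ (hMmono hIJ.le),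
      idemCore_mono e (hSmono hIJ.le), idemHull_mono e (hSmono hIJ.le)⟩
      fun hge => hIJ.not_ge ?_
    have hinf : M J ⊓ L ≤ M I ⊓ L := hge.1
    have hsup : M J ⊔ L ≤ M I ⊔ L := hA.le_of_idemCore_le_of_idemHull_le h2 h3 he hω (hS J)
      (hSmono hIJ.le) hge.2.1 hge.2.2
    -- Modular law: comparable subspaces with equal meet and join with `L` coincide.
    have heq : M I = M J := eq_of_le_of_inf_le_of_sup_le (hMmono hIJ.le) hinf hsup
    exact (Submodule.map_injective_of_injective (baridealIncl_injective ω) heq).ge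

end Chains

end BernsteinAlgebra
theorem theorem3p1 {K : Type*} [Field K] [Infinite K]
    (hchar2 : ringChar K ≠ 2) (hchar3 : ringChar K ≠ 3)
    {A : Type*} [NonUnitalNonAssocCommRing A] [Module K A]
    [IsScalarTower K A A] [SMulCommClass K A A]
    (ω : A →ₙₐ[K] K) (hA : BernsteinAlgebra.IsBernstein ω) :
    ((∃ e : A, e ≠ 0 ∧ e * e = e) ∧
      ∀ e : A, e ≠ 0 → e * e = e →
        DirectSum.IsInternal
          ![Submodule.span K {e}, BernsteinAlgebra.peirceU K e, BernsteinAlgebra.peirceV K e] ∧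
        (BernsteinAlgebra.barideal ω).toSubmodule =
          BernsteinAlgebra.peirceU K e ⊔ BernsteinAlgebra.peirceV K e) ∧
    (BernsteinAlgebra.IsNoetherianAlg K A ↔
      BernsteinAlgebra.IsNoetherianAlg K (BernsteinAlgebra.barideal ω)) ∧
    (BernsteinAlgebra.IsArtinianAlg K A ↔
      BernsteinAlgebra.IsArtinianAlg K (BernsteinAlgebra.barideal ω)) := by
  have h2 : (2 : K) ≠ 0 := Ring.two_ne_zero hchar2
  have h3 := BernsteinAlgebra.three_ne_zero_of_ringChar_ne hchar3
  obtain ⟨F, hF⟩ := hA.exists_strictMono h2 h3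
  have hG := BernsteinAlgebra.strictMono_restrictIdeal_prod ω
  refine ⟨⟨hA.exists_idempotent, fun e h0 he => ?_⟩, ?_, ?_⟩
  · have hω := hA.weight_idempotent h0 he
    exact ⟨hA.isInternal_peirce h2 h3 he hω, hA.barideal_eq_sup h2 h3 he hω⟩
  · rw [BernsteinAlgebra.isNoetherianAlg_iff, BernsteinAlgebra.isNoetherianAlg_iff]
    exact ⟨fun _ => hF.wellFoundedGT, fun _ => hG.wellFoundedGT⟩
  · rw [BernsteinAlgebra.isArtinianAlg_iff, BernsteinAlgebra.isArtinianAlg_iff]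
    exact ⟨fun _ => hF.wellFoundedLT, fun _ => hG.wellFoundedLT⟩
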